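/- A group $G$ is *residually solvable* if for every $g \in G$ with $g \neq 1$ there is a normal subgroup $N$ of $G$ such that $G/N$ is solvable and $g \notin N$. Given a group $G$, subgroups $A, B \leq G$, an isomorphism $\phi : B \to A$ and an integer $k \geq 1$, let $G_i$, for $i \in \mathbb{Z}/k\mathbb{Z}$, be copies of $G$, write $g_i$ for the copy of $g \in G$ in $G_i$, and define $$\overline{\mathrm{Hig}}_k(G,\phi) := \langle\, G_i \ (i \in \mathbb{Z}/k\mathbb{Z}) \mid b_i = \phi(b)_{i+1} \text{ for all } b \in B \text{ and } i \in \mathbb{Z}/k\mathbb{Z} \,\rangle,$$ $$\mathrm{Hig}_k(G,\phi) := \langle\, G, t \mid t^k = 1,\ t^{-1} b t = \phi(b) \text{ for all } b \in B \,\rangle.$$ **Theorem.** Let $G$ be a residually solvable group and let $\phi : B \to A$ be an isomorphism between subgroups $A, B \leq G$. Suppose that there is a group homomorphism $\pi : G \to A \times B$ such that $\pi(a) = (a,1)$ for all $a \in A$ and $\pi(b) = (1,b)$ for all $b \in B$. Then $\mathrm{Hig}_k(G,\phi)$ and $\overline{\mathrm{Hig}}_k(G,\phi)$ are residually solvable for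 all $k \geq 4$. -/

import Mathlib

namespace Higman

/-- A group is residually solvable when every non-trivial element survives in some solvable
quotient. -/
def ResiduallySolvable (G : Type*) [Group G] : Prop :=
  ∀ g : G, g ≠ 1 → ∃ (N : Subgroup G) (_ : N.Normal), Group.IsSolvable (G ⧸ N) ∧ g ∉ N

section

variable {G : Type*} [Group G] {A B : Subgroup G}

/-- The relators `bᵢ (φ b)ᵢ₊₁⁻¹`, for `b ∈ B` and `i` modulo `k`, in the free product of `k` copies
of `G`, the copies being indexed by the residues modulo `k`. -/
def barRelators (k : ℕ) (φ : B ≃* A) : Set (Monoid.CoprodI (fun _ : ZMod k => G)) :=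
  {r | ∃ (i : ZMod k) (b : B),
    r = (Monoid.CoprodI.of (M := fun _ : ZMod k => G) (i := i) (b : G)) *
      (Monoid.CoprodI.of (M := fun _ : ZMod k => G) (i := i + 1) (φ b : G))⁻¹}

/-- The group `⟨G₁, …, G_k ∣ bᵢ = φᵢ(bᵢ)⟩`: the free product of `k` copies of `G` in which `B` in
the `i`-th copy is identified through `φ` with `A` in the `(i+1)`-st copy, indices modulo `k`
(meant for `k ≥ 1`). -/
abbrev HigBar (k : ℕ) (φ : B ≃* A) : Type _ :=
  Monoid.CoprodI (fun _ : ZMod k => G) ⧸ Subgroup.normalClosure (barRelators k φ)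

/-- The stable letter `t`: the generator of the infinite cyclic factor of `G ∗ ℤ`. -/
def stableLetter (G : Type*) [Group G] : Monoid.Coprod G (Multiplicative ℤ) :=
  Monoid.Coprod.inr (Multiplicative.ofAdd 1)

/-- The relators `t ^ k` and `t⁻¹ b t (φ b)⁻¹`, for `b ∈ B`, in the free product `G ∗ ⟨t⟩`. -/
def relators (k : ℕ) (φ : B ≃* A) : Set (Monoid.Coprod G (Multiplicative ℤ)) :=
  {stableLetter G ^ k} ∪
    {r | ∃ b : B, r = (stableLetter G)⁻¹ * Monoid.Coprod.inl (b : G) * stableLetter G *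
      (Monoid.Coprod.inl (φ b : G))⁻¹}

/-- The group `⟨G, t ∣ t ^ k = 1, t⁻¹ b t = φ(b) for all b ∈ B⟩`. -/
abbrev Hig (k : ℕ) (φ : B ≃* A) : Type _ :=
  Monoid.Coprod G (Multiplicative ℤ) ⧸ Subgroup.normalClosure (relators k φ)

end

end Higman

/-! Cut the cycle of `k ≥ 4` copies of `G` into two chains, each of at least two copies. The cyclic
group is the amalgam of the two chain groups over the free product `B ∗ B` of the two outer end
subgroups. Because `π` gives retractions of `G` onto `A` killing `B` and onto `B` killing `A`, each
chain group retracts onto `B ∗ B`: its end copies go to the two factors and any inner copies die.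
Each chain is itself an iterated amalgam over retracts.

Everything thus rests on `residuallySolvable_pushoutI`: an amalgam of residually solvable groups
over a common retract `C` is residually solvable. A normal form with non-trivial head in `C` is
detected by retracting to `C`. Otherwise all letters lie in kernels of the retractions; after
passing to solvable quotients, iterated twisted wreath products (`Separator`) give a solvable group
in which the word survives. Finally, `Hig` embeds in `HigBar ⋊ ℤ/k`, an extension of a residually
solvable group by a solvable one. -/

namespace Higman

universe u v

/-! ### Residual solvability through the derived series. -/

section ResiduallySolvable

variable {G H : Type*} [Group G] [Group H]

theorem isSolvable_quotient_derivedSeries (n : ℕ) : Group.IsSolvable (G ⧸ derivedSeries G n) := by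
  refine (Group.isSolvable_def _).2 ⟨n, ?_⟩
  rw [← map_derivedSeries_eq (QuotientGroup.mk'_surjective (derivedSeries G n)),
    Subgroup.map_eq_bot_iff, QuotientGroup.ker_mk']

theorem residuallySolvable_iff_derivedSeries :
    ResiduallySolvable G ↔ ∀ g : G, g ≠ 1 → ∃ n, g ∉ derivedSeries G n := by
  constructor
  · intro h g hg
    obtain ⟨N, hN, hs, hgN⟩ := h g hg
    obtain ⟨n, hn⟩ := (Group.isSolvable_def _).1 hs
    refine ⟨n, fun hmem => hgN ?_⟩
    have := map_derivedSeries_le_derivedSeries (QuotientGroup.mk' N) n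
      (Subgroup.mem_map_of_mem _ hmem)
    rw [hn, Subgroup.mem_bot] at this
    exact (QuotientGroup.eq_one_iff g).1 this
  · intro h g hg
    obtain ⟨n, hn⟩ := h g hg
    exact ⟨derivedSeries G n, derivedSeries_normal G n, isSolvable_quotient_derivedSeries n, hn⟩

theorem residuallySolvable_of_isSolvable [hG : Group.IsSolvable G] : ResiduallySolvable G := by
  rw [residuallySolvable_iff_derivedSeries]
  obtain ⟨n, hn⟩ := (Group.isSolvable_def _).1 hG
  exact fun g hg => ⟨n, by rwa [hn, Subgroup.mem_bot]⟩

theorem ResiduallySolvable.exists_notMem_derivedSeries_of_map_ne_one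
    (hH : ResiduallySolvable H) (f : G →* H) {g : G} (hg : f g ≠ 1) :
    ∃ n, g ∉ derivedSeries G n := by
  obtain ⟨n, hn⟩ := residuallySolvable_iff_derivedSeries.1 hH _ hg
  exact ⟨n, fun hmem =>
    hn (map_derivedSeries_le_derivedSeries f n (Subgroup.mem_map_of_mem _ hmem))⟩

theorem ResiduallySolvable.of_injective (hH : ResiduallySolvable H) (f : G →* H)
    (hf : Function.Injective f) : ResiduallySolvable G :=
  residuallySolvable_iff_derivedSeries.2 fun _ hg =>
    hH.exists_notMem_derivedSeries_of_map_ne_one f ((map_ne_one_iff f hf).2 hg)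

theorem ResiduallySolvable.semidirectProduct (hG : ResiduallySolvable G) [Group.IsSolvable H]
    (θ : H →* MulAut G) : ResiduallySolvable (G ⋊[θ] H) := by
  rw [residuallySolvable_iff_derivedSeries] at hG ⊢
  intro g hg
  obtain ⟨m, hm⟩ := (Group.isSolvable_def H).1 inferInstance
  by_contra! hmem
  -- The `m`-th derived subgroup already dies in `H`, so it lies in `G`; from there on the two
  -- derived series can be compared.
  have key : ∀ n, derivedSeries (G ⋊[θ] H) (m + n) ≤
      (derivedSeries G n).map SemidirectProduct.inl := by
    intro n
    induction n with
    | zero =>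
      intro x hx
      have := map_derivedSeries_le_derivedSeries SemidirectProduct.rightHom m
        (Subgroup.mem_map_of_mem _ hx)
      rw [hm, Subgroup.mem_bot] at this
      have hx' : x ∈ (SemidirectProduct.rightHom : G ⋊[θ] H →* H).ker := this
      rw [← SemidirectProduct.range_inl_eq_ker_rightHom] at hx'
      obtain ⟨y, rfl⟩ := hx'
      exact ⟨y, by simp, rfl⟩
    | succ n ih =>
      rw [← add_assoc, derivedSeries_succ, derivedSeries_succ, Subgroup.map_commutator]
      exact Subgroup.commutator_mono ih ih
  obtain ⟨y, -, rfl⟩ := key 0 (hmem _)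
  obtain ⟨n, hn⟩ := hG y (by rintro rfl; exact hg (map_one _))
  obtain ⟨z, hz, hzy⟩ := key n (hmem _)
  exact hn (SemidirectProduct.inl_injective hzy ▸ hz)

end ResiduallySolvable

section Solvable

theorem isSolvable_pi (Ω : Type*) (S : Type*) [Group S] [Group.IsSolvable S] :
    Group.IsSolvable (Ω → S) := by
  obtain ⟨n, hn⟩ := (Group.isSolvable_def S).1 inferInstance
  refine (Group.isSolvable_def _).2 ⟨n, (Subgroup.eq_bot_iff_forall _).2 fun f hf => ?_⟩
  ext ω
  have := map_derivedSeries_le_derivedSeries (Pi.evalMonoidHom (fun _ : Ω => S) ω) n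
    (Subgroup.mem_map_of_mem _ hf)
  rwa [hn, Subgroup.mem_bot] at this

theorem isSolvable_semidirectProduct {N Q : Type*} [Group N] [Group Q] [Group.IsSolvable N]
    [Group.IsSolvable Q] (θ : Q →* MulAut N) : Group.IsSolvable (N ⋊[θ] Q) :=
  Group.isSolvable_of_ker_le_range SemidirectProduct.inl SemidirectProduct.rightHom
    SemidirectProduct.range_inl_eq_ker_rightHom.ge

end Solvable

/-! ### Twisted wreath products and their action. -/

section TwistedWreath

variable {Q S : Type*} (Ω : Type*) [Group Q] [Group S] [MulAction Q Ω] (κ : Q →* S)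

/-- The action of `Q` on functions `Ω → S` that translates the argument and conjugates the value
through `κ : Q →* S`. -/
def twistedAut : Q →* MulAut (Ω → S) where
  toFun q :=
    { toFun f := fun ω => κ q * f (q⁻¹ • ω) * (κ q)⁻¹
      invFun f := fun ω => (κ q)⁻¹ * f (q • ω) * κ q
      left_inv f := by ext ω; simp [mul_assoc]
      right_inv f := by ext ω; simp [mul_assoc]
      map_mul' f g := by ext ω; simp [mul_assoc] }
  map_one' := by ext f ω; simp
  map_mul' q q' := by ext f ω; simp [mul_assoc, mul_smul]

theorem twistedAut_apply (q : Q) (f : Ω → S) (ω : Ω) :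
    twistedAut Ω κ q f ω = κ q * f (q⁻¹ • ω) * (κ q)⁻¹ := rfl

/-- The twisted wreath product acts on `Ω × S`. -/
@[reducible]
def twistedAction : MulAction ((Ω → S) ⋊[twistedAut Ω κ] Q) (Ω × S) where
  smul w z := (w.right • z.1, w.left (w.right • z.1) * (κ w.right * z.2 * (κ w.right)⁻¹))
  one_smul z := by
    change ((1 : Q) • z.1, (1 : S) * (κ 1 * z.2 * (κ 1)⁻¹)) = z
    simp
  mul_smul w w' z := by
    change ((w.right * w'.right) • z.1,
        w.left ((w.right * w'.right) • z.1) *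
          (twistedAut Ω κ w.right w'.left ((w.right * w'.right) • z.1)) *
          (κ (w.right * w'.right) * z.2 * (κ (w.right * w'.right))⁻¹)) =
      (w.right • w'.right • z.1, w.left (w.right • w'.right • z.1) *
        (κ w.right * (w'.left (w'.right • z.1) *
          (κ w'.right * z.2 * (κ w'.right)⁻¹)) * (κ w.right)⁻¹))
    simp [twistedAut_apply, mul_smul, mul_assoc]

end TwistedWreath

/-! ### Solvable groups detecting a given alternating word. -/

section Separator

variable {ι : Type v} {X : ι → Type u} {C : Type u} [∀ k, Group (X k)] [Group C]

/-- A solvable group `Q`, receiving compatible homomorphisms from the groups `X k` and acting on a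
set `Ω` in such a way that the product of the word `l` moves `point` into the set `active` while the
products of all proper suffixes of `l` do not. -/
structure Separator (φ : ∀ k, C →* X k) (r : ∀ k, X k →* C) (l : List (Σ k, X k)) where
  Q : Type u
  [group : Group Q]
  solvable : Group.IsSolvable Q
  Ω : Type u
  [action : MulAction Q Ω]
  proj : Q →* C
  hom : ∀ k, X k →* Q
  baseHom : C →* Q
  hom_base : ∀ k c, hom k (φ k c) = baseHom c
  proj_hom : ∀ k x, proj (hom k x) = r k x
  point : Ω
  active : Set Ω
  -- Needed for the next letter to be prepended, whose index differs from that of the head.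
  invariant : ∀ k, (∀ y ∈ l.head?, y.1 ≠ k) → ∀ x ω, hom k x • ω ∈ active ↔ ω ∈ active
  smul_mem : (l.map fun y => hom y.1 y.2).prod • point ∈ active
  suffix_smul_notMem : ∀ m, m <:+ l → m ≠ l →
    (m.map fun y => hom y.1 y.2).prod • point ∉ active

attribute [instance] Separator.group Separator.action

variable {φ : ∀ k, C →* X k} {r : ∀ k, X k →* C}

/-- The separator of the empty word. -/
def Separator.nil [hC : Group.IsSolvable C] (hr : ∀ k c, r k (φ k c) = c) :
    Separator φ r [] where
  Q := C
  solvable := hC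
  Ω := PUnit
  action := { smul := fun _ ω => ω, one_smul := fun _ => rfl, mul_smul := fun _ _ _ => rfl }
  proj := MonoidHom.id C
  hom := r
  baseHom := MonoidHom.id C
  hom_base := hr
  proj_hom _ _ := rfl
  point := PUnit.unit
  active := Set.univ
  invariant := by simp
  smul_mem := trivial
  suffix_smul_notMem m hm hne := absurd (List.suffix_nil.1 hm) hne

open Classical in
/-- The homomorphism from `X i` to the twisted wreath product under which `x` multiplies the new
coordinate by `x (r x)⁻¹` over active points. -/
noncomputable def Separator.activeHom {l : List (Σ k, X k)} (P : Separator φ r l) (i : ι)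
    (hi : ∀ y ∈ l.head?, y.1 ≠ i) :
    X i →* (P.Ω → X i) ⋊[twistedAut P.Ω ((φ i).comp P.proj)] P.Q where
  -- The map `x ↦ x (φ (r x))⁻¹` is a cocycle for conjugation through `φ ∘ r`; invariance of the
  -- active set lets it be switched on there only. Over an active image point, `x` sends the second
  -- coordinate `s` to `x s (φ (r x))⁻¹`.
  toFun x := ⟨fun ω => if ω ∈ P.active then x * (φ i (r i x))⁻¹ else 1, P.hom i x⟩
  map_one' := by
    ext ω
    · simp
    · simp
  map_mul' x y := by
    have h : ∀ ω, (P.hom i x)⁻¹ • ω ∈ P.active ↔ ω ∈ P.active := fun ω => by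
      rw [← map_inv]; exact P.invariant i hi _ _
    ext ω
    · by_cases hω : ω ∈ P.active
      · simp [twistedAut_apply, h, hω, P.proj_hom, mul_assoc]
      · simp [twistedAut_apply, h, hω]
    · simp

/-- The second coordinate stays `1` while the letters of `l` act, since active points are reached
only once all of `l` has acted. The new letter then turns it into `x ≠ 1`. The other factors act on
this coordinate by conjugation, so the condition `≠ 1` is invariant under them. -/
theorem Separator.nonempty_cons [DecidableEq ι] [∀ k, Group.IsSolvable (X k)]
    (hr : ∀ k c, r k (φ k c) = c) {l : List (Σ k, X k)} (P : Separator φ r l)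
    (y : Σ k, X k) (hi : ∀ z ∈ l.head?, z.1 ≠ y.1) (hy1 : y.2 ≠ 1) (hyr : r y.1 y.2 = 1) :
    Nonempty (Separator φ r (y :: l)) := by
  obtain ⟨i, x⟩ := y
  dsimp only at hi hy1 hyr
  let κ : P.Q →* X i := (φ i).comp P.proj
  let W := (P.Ω → X i) ⋊[twistedAut P.Ω κ] P.Q
  let act : MulAction W (P.Ω × X i) := twistedAction P.Ω κ
  have smul_def : ∀ (w : W) (z : P.Ω × X i),
      w • z = (w.right • z.1, w.left (w.right • z.1) * (κ w.right * z.2 * (κ w.right)⁻¹)) :=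
    fun _ _ => rfl
  let h : ∀ k, X k →* W := Function.update
    (fun k => (SemidirectProduct.inr : P.Q →* W).comp (P.hom k)) i (P.activeHom i hi)
  have h_self : h i = P.activeHom i hi := Function.update_self ..
  have h_ne : ∀ k, k ≠ i → ∀ x, h k x = SemidirectProduct.inr (P.hom k x) := fun k hk x => by
    simp only [h, Function.update_of_ne hk]; rfl
  have h_right : ∀ k x, (h k x).right = P.hom k x := fun k x => by
    by_cases hk : k = i
    · subst hk; rw [h_self]; rfl
    · rw [h_ne k hk]; rfl
  have h_left : ∀ k x ω, ω ∉ P.active → (h k x).left ω = 1 := fun k x ω hω => by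
    by_cases hk : k = i
    · subst hk; rw [h_self]; exact if_neg hω
    · rw [h_ne k hk]; rfl
  have suffix_smul : ∀ m, m <:+ l → (m.map fun y => h y.1 y.2).prod • (P.point, (1 : X i)) =
      ((m.map fun y => P.hom y.1 y.2).prod • P.point, 1) := by
    intro m
    induction m with
    | nil => intro _; simp
    | cons z m ih =>
      intro hm
      have hm' : m <:+ l := (List.suffix_cons z m).trans hm
      have hne : m ≠ l := by
        rintro rfl
        exact absurd hm.length_le (by simp)
      have hna := P.suffix_smul_notMem m hm' hne
      rw [List.map_cons, List.prod_cons, mul_smul, ih hm', smul_def, h_right, List.map_cons,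
        List.prod_cons, mul_smul]
      congr 1
      have : (h z.1 z.2).left (P.hom z.1 z.2 • (m.map fun y => P.hom y.1 y.2).prod • P.point)
          = 1 := by
        by_cases hz : z.1 = i
        · obtain ⟨k, a⟩ := z
          dsimp only at hz
          subst hz
          exact h_left _ _ _ (by rwa [P.invariant _ hi])
        · rw [h_ne _ hz]; rfl
      rw [this]; simp
  refine ⟨{
    Q := W
    solvable := ?_
    Ω := P.Ω × X i
    action := act
    proj := P.proj.comp SemidirectProduct.rightHom
    hom := h
    baseHom := (SemidirectProduct.inr : P.Q →* W).comp P.baseHom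
    hom_base := ?_
    proj_hom := ?_
    point := (P.point, 1)
    active := {z | z.2 ≠ 1}
    invariant := ?_
    smul_mem := ?_
    suffix_smul_notMem := ?_ }⟩
  · have := P.solvable
    have := isSolvable_pi P.Ω (X i)
    exact isSolvable_semidirectProduct _
  -- The cocycle is trivial on the image of `C`, so the altered factor still agrees with the others
  -- there.
  · intro k c
    by_cases hk : k = i
    · subst hk
      rw [h_self]
      ext ω
      · simp [Separator.activeHom, hr]
      · simp [Separator.activeHom, P.hom_base]
    · rw [h_ne k hk, P.hom_base]; rfl
  · intro k x
    rw [MonoidHom.comp_apply, SemidirectProduct.rightHom_eq_right, h_right, P.proj_hom]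
  · intro k hk a z
    have hk' : k ≠ i := fun h => hk ⟨i, x⟩ (by simp) h.symm
    rw [h_ne k hk', smul_def]
    simp
  · rw [List.map_cons, List.prod_cons, mul_smul, suffix_smul l List.suffix_rfl, smul_def, h_right,
      h_self]
    have hmem := (P.invariant i hi x _).2 P.smul_mem
    simp [Separator.activeHom, hmem, hyr, hy1]
  · intro m hm hne
    rcases List.suffix_cons_iff.1 hm with rfl | hm
    · exact absurd rfl hne
    · rw [suffix_smul m hm]; simp

theorem Separator.nonempty [∀ k, Group.IsSolvable (X k)] [Group.IsSolvable C]
    (hr : ∀ k c, r k (φ k c) = c) (l : List (Σ k, X k))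
    (hl : l.IsChain fun y z => y.1 ≠ z.1) (hmem : ∀ y ∈ l, y.2 ≠ 1 ∧ r y.1 y.2 = 1) :
    Nonempty (Separator φ r l) := by
  classical
  induction l with
  | nil => exact ⟨.nil hr⟩
  | cons y l ih =>
    rw [List.isChain_cons] at hl
    obtain ⟨P⟩ := ih hl.2 fun z hz => hmem z (by simp [hz])
    exact P.nonempty_cons hr y (fun z hz => (hl.1 z hz).symm) (hmem y (by simp)).1
      (hmem y (by simp)).2

end Separator

/-! ### Amalgams over a common retract. -/

section Pushout

variable {ι : Type v} {X : ι → Type u} {C : Type u} [∀ k, Group (X k)] [Group C]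
  {φ : ∀ k, C →* X k} {r : ∀ k, X k →* C}

theorem Separator.prod_ne_one {l : List (Σ k, X k)} (P : Separator φ r l) (hl : l ≠ []) :
    (l.map fun y => P.hom y.1 y.2).prod ≠ 1 := fun h => by
  have h₁ := P.smul_mem
  have h₂ := P.suffix_smul_notMem [] List.nil_suffix hl.symm
  rw [h] at h₁
  exact h₂ h₁

theorem exists_forall_mem_notMem_derivedSeries (hX : ∀ k, ResiduallySolvable (X k))
    (l : List (Σ k, X k)) (hl : ∀ y ∈ l, y.2 ≠ 1) :
    ∃ n, ∀ y ∈ l, y.2 ∉ derivedSeries (X y.1) n := by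
  induction l with
  | nil => exact ⟨0, by simp⟩
  | cons y l ih =>
    obtain ⟨n, hn⟩ := ih fun z hz => hl z (by simp [hz])
    obtain ⟨m, hm⟩ := residuallySolvable_iff_derivedSeries.1 (hX y.1) y.2 (hl y (by simp))
    refine ⟨max m n, fun z hz hmem => ?_⟩
    rcases List.mem_cons.1 hz with rfl | hz
    · exact hm (derivedSeries_antitone _ (le_max_left _ _) hmem)
    · exact hn z hz (derivedSeries_antitone _ (le_max_right _ _) hmem)

/-- The homomorphism induced on the quotients by the `n`-th derived subgroups. -/
def derivedQuotientMap {G H : Type*} [Group G] [Group H] (f : G →* H) (n : ℕ) :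
    G ⧸ derivedSeries G n →* H ⧸ derivedSeries H n :=
  QuotientGroup.map _ _ f (Subgroup.map_le_iff_le_comap.1 (map_derivedSeries_le_derivedSeries f n))

theorem derivedQuotientMap_mk {G H : Type*} [Group G] [Group H] (f : G →* H) (n : ℕ) (g : G) :
    derivedQuotientMap f n (QuotientGroup.mk' _ g) = QuotientGroup.mk' _ (f g) := rfl

/-- One `n` keeps every letter non-trivial modulo the `n`-th derived subgroups. These are
functorial, so the retractions descend to the quotients. -/
theorem exists_isSolvable_separating (hX : ∀ k, ResiduallySolvable (X k))
    (hr : ∀ k c, r k (φ k c) = c) (l : List (Σ k, X k)) (hne : l ≠ [])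
    (hl : l.IsChain fun y z => y.1 ≠ z.1) (hmem : ∀ y ∈ l, y.2 ≠ 1 ∧ r y.1 y.2 = 1) :
    ∃ (Q : Type u) (_ : Group Q) (_ : Group.IsSolvable Q) (h : ∀ k, X k →* Q) (e : C →* Q),
      (∀ k, (h k).comp (φ k) = e) ∧ (l.map fun y => h y.1 y.2).prod ≠ 1 := by
  obtain ⟨n, hn⟩ := exists_forall_mem_notMem_derivedSeries hX l fun y hy => (hmem y hy).1
  let mkX : ∀ k, X k →* X k ⧸ derivedSeries (X k) n := fun k => QuotientGroup.mk' _
  let mkC : C →* C ⧸ derivedSeries C n := QuotientGroup.mk' _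
  let l' : List (Σ k, X k ⧸ derivedSeries (X k) n) := l.map fun y => ⟨y.1, mkX y.1 y.2⟩
  have : ∀ k, Group.IsSolvable (X k ⧸ derivedSeries (X k) n) := fun k =>
    isSolvable_quotient_derivedSeries n
  have : Group.IsSolvable (C ⧸ derivedSeries C n) := isSolvable_quotient_derivedSeries n
  obtain ⟨P⟩ := Separator.nonempty (φ := fun k => derivedQuotientMap (φ k) n)
    (r := fun k => derivedQuotientMap (r k) n)
    (fun k c => by
      obtain ⟨c, rfl⟩ := QuotientGroup.mk'_surjective _ c
      rw [derivedQuotientMap_mk, derivedQuotientMap_mk, hr]) l'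
    ((List.isChain_map _).2 hl) (fun z hz => by
      obtain ⟨y, hy, rfl⟩ := List.mem_map.1 hz
      refine ⟨fun h => hn y hy ((QuotientGroup.eq_one_iff _).1 h), ?_⟩
      change derivedQuotientMap (r y.1) n (QuotientGroup.mk' _ y.2) = 1
      rw [derivedQuotientMap_mk, (hmem y hy).2, map_one])
  refine ⟨P.Q, P.group, P.solvable, fun k => (P.hom k).comp (mkX k), P.baseHom.comp mkC,
    fun k => MonoidHom.ext fun c => P.hom_base k (mkC c), ?_⟩
  have := P.prod_ne_one (by simpa [l'] using hne)
  rwa [List.map_map] at this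

/-- The kernels of retractions onto the amalgamated subgroup form a transversal. -/
def kerTransversal (hr : ∀ k c, r k (φ k c) = c) : Monoid.PushoutI.NormalWord.Transversal φ where
  injective k := Function.LeftInverse.injective (hr k)
  set k := (r k).ker
  one_mem k := one_mem _
  compl k := by
    refine ⟨?_, fun x => ?_⟩
    · rintro ⟨⟨_, c, rfl⟩, ⟨s, hs⟩⟩ ⟨⟨_, c', rfl⟩, ⟨s', hs'⟩⟩ h
      dsimp only at h
      have hc := congrArg (r k) h
      rw [map_mul, map_mul, hr, hr, show r k s = 1 from hs, show r k s' = 1 from hs', mul_one,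
        mul_one] at hc
      subst hc
      simpa using h
    · exact ⟨⟨⟨φ k (r k x), r k x, rfl⟩, ⟨(φ k (r k x))⁻¹ * x, by
        simp [MonoidHom.mem_ker, hr]⟩⟩, by simp⟩

theorem residuallySolvable_pushoutI (hX : ∀ k, ResiduallySolvable (X k))
    (hC : ResiduallySolvable C) (hr : ∀ k c, r k (φ k c) = c) :
    ResiduallySolvable (Monoid.PushoutI φ) := by
  classical
  rw [residuallySolvable_iff_derivedSeries]
  intro g hg
  obtain ⟨w, rfl⟩ := (Monoid.PushoutI.NormalWord.equiv (d := kerTransversal hr)).symm.surjective g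
  change w.prod ≠ 1 at hg
  change ∃ n, w.prod ∉ derivedSeries _ n
  have hker : ∀ y ∈ w.toList, r y.1 y.2 = 1 := fun y hy => w.normalized y.1 y.2 hy
  have hprod : w.prod = Monoid.PushoutI.base φ w.head *
      (w.toList.map fun y => Monoid.PushoutI.of (φ := φ) y.1 y.2).prod := by
    simp only [Monoid.PushoutI.NormalWord.prod, Monoid.CoprodI.Word.prod, map_list_prod,
      List.map_map]
    rfl
  rw [hprod] at hg ⊢
  by_cases hhead : w.head = 1
  · rw [hhead, map_one, one_mul] at hg ⊢
    obtain ⟨Q, _, hQ, h, e, he, hne⟩ := exists_isSolvable_separating hX hr w.toList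
      (by rintro h; simp [h] at hg) w.chain_ne fun y hy => ⟨w.ne_one y hy, hker y hy⟩
    have hQ' : ResiduallySolvable Q := residuallySolvable_of_isSolvable
    refine hQ'.exists_notMem_derivedSeries_of_map_ne_one (Monoid.PushoutI.lift h e he) ?_
    rw [map_list_prod, List.map_map]
    simpa [Function.comp_def] using hne
  · refine hC.exists_notMem_derivedSeries_of_map_ne_one
      (Monoid.PushoutI.lift r (MonoidHom.id C) fun k => MonoidHom.ext (hr k)) ?_
    rw [map_mul, map_list_prod, List.map_map, List.prod_eq_one, mul_one]
    · simpa using hhead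
    · intro c hc
      obtain ⟨y, hy, rfl⟩ := List.mem_map.1 hc
      simpa using hker y hy

theorem exists_residuallySolvable_pushout [Nonempty ι] (hX : ∀ k, ResiduallySolvable (X k))
    (hr : ∀ k c, r k (φ k c) = c) :
    ∃ (Z : Type (max u v)) (_ : Group Z) (j : ∀ k, X k →* Z), ResiduallySolvable Z ∧
      (∀ k l c, j k (φ k c) = j l (φ l c)) ∧
      ∀ (H : Type u) [Group H] (f : ∀ k, X k →* H), (∀ k l c, f k (φ k c) = f l (φ l c)) →
        ∃ F : Z →* H, ∀ k x, F (j k x) = f k x := by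
  obtain ⟨k₀⟩ := ‹Nonempty ι›
  refine ⟨Monoid.PushoutI φ, inferInstance, fun k => Monoid.PushoutI.of (φ := φ) k,
    residuallySolvable_pushoutI hX
      ((hX k₀).of_injective _ (Function.LeftInverse.injective (hr k₀))) hr, fun k l c => ?_,
    fun H _ f hf => ?_⟩
  · exact (Monoid.PushoutI.of_apply_eq_base φ k c).trans
      (Monoid.PushoutI.of_apply_eq_base φ l c).symm
  · have h : ∀ k, (f k).comp (φ k) = (f k₀).comp (φ k₀) := fun k =>
      MonoidHom.ext fun c => hf k k₀ c
    exact ⟨Monoid.PushoutI.lift f _ h, fun k x => Monoid.PushoutI.lift_of f _ h x⟩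

/-- The amalgamated product of two residually solvable groups over a common retract is residually
solvable. -/
theorem exists_residuallySolvable_amalgam {X Y C : Type u} [hX' : Group X] [hY' : Group Y] [Group C]
    (hX : ResiduallySolvable X) (hY : ResiduallySolvable Y) {a : C →* X} {b : C →* Y}
    {p : X →* C} {q : Y →* C} (hp : ∀ c, p (a c) = c) (hq : ∀ c, q (b c) = c) :
    ∃ (Z : Type u) (_ : Group Z) (i : X →* Z) (j : Y →* Z), ResiduallySolvable Z ∧
      (∀ c, i (a c) = j (b c)) ∧
      ∀ (H : Type u) [Group H] (f : X →* H) (g : Y →* H), (∀ c, f (a c) = g (b c)) →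
        ∃ F : Z →* H, (∀ x, F (i x) = f x) ∧ ∀ y, F (j y) = g y := by
  let W : Bool → Type u := fun s => cond s X Y
  let grp : ∀ s, Group (W s) := Bool.rec hY' hX'
  let φ : ∀ s, C →* W s := Bool.rec b a
  let r : ∀ s, W s →* C := Bool.rec q p
  obtain ⟨Z, hZ', j, hZ, hj, lift⟩ := exists_residuallySolvable_pushout (X := W) (φ := φ) (r := r)
    (Bool.rec hY hX) (Bool.rec hq hp)
  refine ⟨Z, hZ', j true, j false, hZ, hj true false, fun H _ f g hfg => ?_⟩
  obtain ⟨F, hF⟩ := lift H (Bool.rec g f) (Bool.rec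
    (Bool.rec (fun _ => rfl) fun c => (hfg c).symm) (Bool.rec hfg fun _ => rfl))
  exact ⟨F, hF true, hF false⟩

end Pushout

/-! ### Chains of copies of `G`. -/

section Chain

/-- The amalgam `G ∗ G ∗ ⋯ ∗ G` of `m + 1` copies of `G`, in which the copies of `B` and `A` in
adjacent factors are identified through `φ`, is residually solvable. -/
theorem exists_residuallySolvable_chain {G : Type u} [Group G] (hG : ResiduallySolvable G)
    {V : Type u} [Group V] {a b : V →* G} {p q : G →* V} (hpa : ∀ v, p (a v) = v)
    (hqa : ∀ v, q (a v) = 1) (hqb : ∀ v, q (b v) = v) (m : ℕ) :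
    ∃ (Y : Type u) (_ : Group Y) (ι : ℕ → G →* Y), ResiduallySolvable Y ∧
      (∀ i < m, ∀ v, ι i (b v) = ι (i + 1) (a v)) ∧
      ∀ (H : Type u) [Group H] (f : ℕ → G →* H),
        (∀ i < m, ∀ v, f i (b v) = f (i + 1) (a v)) →
        ∃ F : Y →* H, ∀ i ≤ m, ∀ g, F (ι i g) = f i g := by
  induction m with
  | zero =>
    refine ⟨G, inferInstance, fun _ => MonoidHom.id G, hG, by simp, fun H _ f _ => ⟨f 0, ?_⟩⟩
    rintro i hi g
    obtain rfl : i = 0 := by omega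
    rfl
  | succ m ih =>
    obtain ⟨Y, _, ι, hY, hι, lift⟩ := ih
    -- The retraction onto `B` in the last copy kills all earlier copies; this is consistent because
    -- `q` kills `A`.
    obtain ⟨ρ, hρ⟩ := lift V (fun i => if i = m then q else 1) (fun i hi v => by
      rw [if_neg hi.ne]
      split_ifs
      · rw [hqa]; rfl
      · rfl)
    have hρb : ∀ v, ρ (ι m (b v)) = v := fun v => by rw [hρ m le_rfl, if_pos rfl, hqb]
    obtain ⟨Z, _, j, j', hZ, hj, liftZ⟩ := exists_residuallySolvable_amalgam hY hG
      (a := (ι m).comp b) (b := a) (p := ρ) (q := p) hρb hpa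
    -- Indices beyond `m + 1` receive a junk value.
    refine ⟨Z, inferInstance, fun i => if i ≤ m then j.comp (ι i) else j', hZ, ?_, ?_⟩
    · intro i hi v
      dsimp only
      rw [if_pos (by omega)]
      split_ifs with h
      · exact congrArg j (hι i (by omega) v)
      · obtain rfl : i = m := by omega
        exact hj v
    · intro H _ f hf
      obtain ⟨F, hF⟩ := lift H f fun i hi => hf i (by omega)
      obtain ⟨F', hF', hF''⟩ := liftZ H F (f (m + 1)) fun v => by
        rw [MonoidHom.comp_apply, hF m le_rfl, hf m (by omega)]
      refine ⟨F', fun i hi g => ?_⟩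
      dsimp only
      split_ifs with h
      · rw [MonoidHom.comp_apply, hF', hF i h]
      · obtain rfl : i = m + 1 := by omega
        exact hF'' g

end Chain

/-! ### Universal property of `HigBar`. -/

section HigBar

variable {G : Type u} [Group G] {A B : Subgroup G} (k : ℕ) (φ : B ≃* A)

/-- The `i`-th copy of `G` in `HigBar k φ`. -/
def HigBar.of (i : ZMod k) : G →* HigBar k φ :=
  (QuotientGroup.mk' _).comp (Monoid.CoprodI.of (M := fun _ : ZMod k => G) (i := i))

theorem HigBar.of_eq (i : ZMod k) (b : B) :
    HigBar.of k φ i (b : G) = HigBar.of k φ (i + 1) (φ b : G) := by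
  rw [← mul_inv_eq_one, ← map_inv]
  exact (QuotientGroup.eq_one_iff _).2 (Subgroup.subset_normalClosure ⟨i, b, by rw [map_inv]⟩)

variable {k φ}

/-- The homomorphism out of `HigBar k φ` given by compatible homomorphisms out of the copies of
`G`. -/
def HigBar.lift {H : Type*} [Group H] (f : ZMod k → G →* H)
    (hf : ∀ i (b : B), f i b = f (i + 1) (φ b)) : HigBar k φ →* H :=
  QuotientGroup.lift _ (Monoid.CoprodI.lift (M := fun _ : ZMod k => G) f) <| by
    refine Subgroup.normalClosure_le_normal ?_
    rintro _ ⟨i, b, rfl⟩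
    simp [MonoidHom.mem_ker, hf]

theorem HigBar.lift_of {H : Type*} [Group H] (f : ZMod k → G →* H)
    (hf : ∀ i (b : B), f i b = f (i + 1) (φ b)) (i : ZMod k) (g : G) :
    HigBar.lift f hf (HigBar.of k φ i g) = f i g :=
  Monoid.CoprodI.lift_of (M := fun _ : ZMod k => G) f g

theorem HigBar.hom_ext {H : Type*} [Group H] {f f' : HigBar k φ →* H}
    (h : ∀ i g, f (HigBar.of k φ i g) = f' (HigBar.of k φ i g)) : f = f' := by
  refine QuotientGroup.monoidHom_ext _ (Monoid.CoprodI.ext_hom _ _ fun i => ?_)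
  exact MonoidHom.ext fun g => h i g

end HigBar

/-! ### Universal property of `Hig`. -/

section Hig

variable {G : Type u} [Group G] {A B : Subgroup G} (k : ℕ) (φ : B ≃* A)

/-- The canonical homomorphism from `G` to `Hig k φ`. -/
def Hig.of : G →* Hig k φ :=
  (QuotientGroup.mk' _).comp Monoid.Coprod.inl

/-- The image of the stable letter in `Hig k φ`. -/
def Hig.t : Hig k φ := QuotientGroup.mk' _ (stableLetter G)

theorem Hig.t_pow : Hig.t k φ ^ k = 1 :=
  (QuotientGroup.eq_one_iff _).2 (Subgroup.subset_normalClosure (Or.inl rfl))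

theorem Hig.t_inv_mul (b : B) :
    (Hig.t k φ)⁻¹ * Hig.of k φ b * Hig.t k φ = Hig.of k φ (φ b) := by
  rw [← mul_inv_eq_one]
  exact (QuotientGroup.eq_one_iff _).2 (Subgroup.subset_normalClosure (Or.inr ⟨b, rfl⟩))

variable {k φ}

/-- The homomorphism out of `Hig k φ` given by a homomorphism out of `G` and the image of the
stable letter. -/
def Hig.lift {H : Type*} [Group H] (f : G →* H) (s : H) (hs : s ^ k = 1)
    (hf : ∀ b : B, s⁻¹ * f b * s = f (φ b)) : Hig k φ →* H :=
  QuotientGroup.lift _ (Monoid.Coprod.lift f (zpowersHom H s)) <| by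
    refine Subgroup.normalClosure_le_normal ?_
    rintro _ (rfl | ⟨b, rfl⟩)
    · simp [MonoidHom.mem_ker, stableLetter, hs]
    · simp [MonoidHom.mem_ker, stableLetter, hf]

theorem Hig.lift_of {H : Type*} [Group H] (f : G →* H) (s : H) (hs : s ^ k = 1)
    (hf : ∀ b : B, s⁻¹ * f b * s = f (φ b)) (g : G) : Hig.lift f s hs hf (Hig.of k φ g) = f g :=
  Monoid.Coprod.lift_apply_inl f (zpowersHom H s) g

theorem Hig.lift_t {H : Type*} [Group H] (f : G →* H) (s : H) (hs : s ^ k = 1)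
    (hf : ∀ b : B, s⁻¹ * f b * s = f (φ b)) : Hig.lift f s hs hf (Hig.t k φ) = s := by
  have h : Monoid.Coprod.lift f (zpowersHom H s) (stableLetter G) = s := by simp [stableLetter]
  exact h

theorem Hig.hom_ext {H : Type*} [Group H] {f f' : Hig k φ →* H}
    (h : ∀ g, f (Hig.of k φ g) = f' (Hig.of k φ g)) (ht : f (Hig.t k φ) = f' (Hig.t k φ)) :
    f = f' := by
  refine QuotientGroup.monoidHom_ext _ (Monoid.Coprod.hom_ext (MonoidHom.ext h) ?_)
  exact MonoidHom.ext_mint ht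

end Hig

/-! ### Embedding `Hig` in a semidirect product. -/

section Shift

variable {G : Type u} [Group G] {A B : Subgroup G} (k : ℕ) (φ : B ≃* A)

/-- The endomorphism of `HigBar k φ` that shifts the indices by `j`. -/
def HigBar.shift (j : ZMod k) : HigBar k φ →* HigBar k φ :=
  HigBar.lift (fun i => HigBar.of k φ (j + i)) fun i b => by rw [HigBar.of_eq, add_assoc]

theorem HigBar.shift_of (j i : ZMod k) (g : G) :
    HigBar.shift k φ j (HigBar.of k φ i g) = HigBar.of k φ (j + i) g :=
  HigBar.lift_of _ _ i g

theorem HigBar.shift_zero : HigBar.shift k φ 0 = MonoidHom.id _ :=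
  HigBar.hom_ext fun i g => by rw [HigBar.shift_of, zero_add]; rfl

theorem HigBar.shift_add (j j' : ZMod k) :
    HigBar.shift k φ (j + j') = (HigBar.shift k φ j).comp (HigBar.shift k φ j') :=
  HigBar.hom_ext fun i g => by
    rw [MonoidHom.comp_apply, HigBar.shift_of, HigBar.shift_of, HigBar.shift_of, add_assoc]

/-- The action of `ℤ/k` on `HigBar k φ` by shifting the indices. -/
def HigBar.shiftAut : Multiplicative (ZMod k) →* MulAut (HigBar k φ) where
  toFun j := (HigBar.shift k φ j.toAdd).toMulEquiv (HigBar.shift k φ (-j.toAdd))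
    (by rw [← HigBar.shift_add, neg_add_cancel, HigBar.shift_zero])
    (by rw [← HigBar.shift_add, add_neg_cancel, HigBar.shift_zero])
  map_one' := MulEquiv.ext fun x => DFunLike.congr_fun (HigBar.shift_zero k φ) x
  map_mul' j j' := MulEquiv.ext fun x =>
    DFunLike.congr_fun (HigBar.shift_add k φ j.toAdd j'.toAdd) x

theorem HigBar.shiftAut_of (j : Multiplicative (ZMod k)) (i : ZMod k) (g : G) :
    HigBar.shiftAut k φ j (HigBar.of k φ i g) = HigBar.of k φ (j.toAdd + i) g :=
  HigBar.shift_of k φ _ i g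

/-- The homomorphism from `ℤ/k` to `Hig k φ` with image generated by the stable letter. -/
def Hig.powers : Multiplicative (ZMod k) →* Hig k φ :=
  AddMonoidHom.toMultiplicativeLeft (ZMod.lift k
    ⟨zmultiplesHom _ (Additive.ofMul (Hig.t k φ)), by
      rw [zmultiplesHom_apply, natCast_zsmul, ← ofMul_pow, Hig.t_pow, ofMul_one]⟩)

theorem Hig.powers_one : Hig.powers k φ (Multiplicative.ofAdd 1) = Hig.t k φ := by
  have h := ZMod.lift_coe k ⟨zmultiplesHom _ (Additive.ofMul (Hig.t k φ)), by
      rw [zmultiplesHom_apply, natCast_zsmul, ← ofMul_pow, Hig.t_pow, ofMul_one]⟩ 1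
  rw [Int.cast_one] at h
  exact (congrArg Additive.toMul h).trans (by simp)

/-- `Hig k φ` is a semidirect product of `HigBar k φ` and `ℤ/k`; here only the embedding. -/
theorem Hig.exists_injective_semidirectProduct :
    ∃ f : Hig k φ →* HigBar k φ ⋊[HigBar.shiftAut k φ] Multiplicative (ZMod k),
      Function.Injective f := by
  let s : HigBar k φ ⋊[HigBar.shiftAut k φ] Multiplicative (ZMod k) :=
    SemidirectProduct.inr (Multiplicative.ofAdd 1)
  let F : Hig k φ →* HigBar k φ ⋊[HigBar.shiftAut k φ] Multiplicative (ZMod k) :=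
    Hig.lift (SemidirectProduct.inl.comp (HigBar.of k φ 0)) s
      (by
        rw [← map_pow, ← ofAdd_nsmul, nsmul_one, ZMod.natCast_self]
        rfl)
      (fun b => by
        rw [MonoidHom.comp_apply, MonoidHom.comp_apply, ← map_inv,
          ← SemidirectProduct.inl_aut_inv, ← map_inv, HigBar.shiftAut_of, HigBar.of_eq]
        simp)
  -- The `i`-th copy goes to `tⁱ G t⁻ⁱ`; the relation `b = t φ(b) t⁻¹` gives compatibility.
  let E : HigBar k φ →* Hig k φ := HigBar.lift
    (fun i => (MulAut.conj (Hig.powers k φ (Multiplicative.ofAdd i))).toMonoidHom.comp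
      (Hig.of k φ))
    (fun i b => by
      simp only [MonoidHom.comp_apply, MulEquiv.coe_toMonoidHom, MulAut.conj_apply]
      rw [← Hig.t_inv_mul, ofAdd_add, map_mul, Hig.powers_one]
      group)
  have hE : ∀ i g, E (HigBar.of k φ i g) = Hig.powers k φ (Multiplicative.ofAdd i) *
      Hig.of k φ g * (Hig.powers k φ (Multiplicative.ofAdd i))⁻¹ := fun i g =>
    HigBar.lift_of _ _ i g
  let D := SemidirectProduct.lift (φ := HigBar.shiftAut k φ) E (Hig.powers k φ) (fun j =>
    HigBar.hom_ext fun i g => by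
      simp only [MonoidHom.comp_apply, MulEquiv.coe_toMonoidHom, MulAut.conj_apply]
      rw [HigBar.shiftAut_of, hE, hE, ofAdd_add, map_mul, ofAdd_toAdd]
      group)
  have hDF : D.comp F = MonoidHom.id _ := by
    refine Hig.hom_ext (fun g => ?_) ?_
    · rw [MonoidHom.comp_apply, Hig.lift_of, MonoidHom.comp_apply, SemidirectProduct.lift_inl, hE]
      simp
    · rw [MonoidHom.comp_apply, Hig.lift_t, SemidirectProduct.lift_inr, Hig.powers_one]
      rfl
  exact ⟨F, Function.LeftInverse.injective (g := D) fun x => DFunLike.congr_fun hDF x⟩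

end Shift

/-! ### Cutting the cycle into two chains. -/

section Main

variable {G : Type u} [Group G] {A B : Subgroup G}

theorem residuallySolvable_higBar (hG : ResiduallySolvable G) (φ : B ≃* A) (π : G →* A × B)
    (hA : ∀ a : A, π a = (a, 1)) (hB : ∀ b : B, π b = (1, b)) (m : ℕ) :
    ResiduallySolvable (HigBar (m + 4) φ) := by
  let a : B →* G := A.subtype.comp φ.toMonoidHom
  let b : B →* G := B.subtype
  let p : G →* B := φ.symm.toMonoidHom.comp ((MonoidHom.fst A B).comp π)
  let q : G →* B := (MonoidHom.snd A B).comp π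
  have hpa : ∀ v, p (a v) = v := fun v => by simp [p, a, hA]
  have hpb : ∀ v, p (b v) = 1 := fun v => by simp [p, b, hB]
  have hqa : ∀ v, q (a v) = 1 := fun v => by simp [q, a, hA]
  have hqb : ∀ v, q (b v) = v := fun v => by simp [q, b, hB]
  -- `X` carries copies `0, 1` and `Y` the remaining `m + 2`. With at least two copies in each, the
  -- two glued subgroups of a chain lie in different copies.
  obtain ⟨X, _, ι, hX, hι, liftX⟩ := exists_residuallySolvable_chain hG hpa hqa hqb 1
  obtain ⟨Y, _, κ, hY, hκ, liftY⟩ := exists_residuallySolvable_chain hG hpa hqa hqb (m + 1)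
  let inl : B →* Monoid.Coprod B B := Monoid.Coprod.inl
  let inr : B →* Monoid.Coprod B B := Monoid.Coprod.inr
  let cX : Monoid.Coprod B B →* X := Monoid.Coprod.lift ((ι 0).comp a) ((ι 1).comp b)
  let cY : Monoid.Coprod B B →* Y := Monoid.Coprod.lift ((κ (m + 1)).comp b) ((κ 0).comp a)
  -- The inner identification is respected because both sides die: `p` kills `B` and `q` kills `A`.
  obtain ⟨rX, hrX⟩ := liftX (Monoid.Coprod B B)
    (fun i => if i = 0 then inl.comp p else inr.comp q) (fun i hi v => by
      obtain rfl : i = 0 := by omega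
      simp [hpb, hqa])
  obtain ⟨rY, hrY⟩ := liftY (Monoid.Coprod B B)
    (fun i => if i = 0 then inr.comp p else if i = m + 1 then inl.comp q else 1) (fun i hi v => by
      rw [if_neg (Nat.succ_ne_zero i)]
      split_ifs <;> first | omega | simp [hpb, hqa])
  have hX' : ∀ c, rX (cX c) = c := fun c => by
    refine DFunLike.congr_fun (f := rX.comp cX) (g := MonoidHom.id _)
      (Monoid.Coprod.hom_ext (MonoidHom.ext fun v => ?_) (MonoidHom.ext fun v => ?_)) c
    · simp [cX, hrX, hpa, inl]
    · simp [cX, hrX, hqb, inr]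
  have hY' : ∀ c, rY (cY c) = c := fun c => by
    refine DFunLike.congr_fun (f := rY.comp cY) (g := MonoidHom.id _)
      (Monoid.Coprod.hom_ext (MonoidHom.ext fun v => ?_) (MonoidHom.ext fun v => ?_)) c
    · simp [cY, hrY, hqb, inl]
    · simp [cY, hrY, hpa, inr]
  obtain ⟨Z, _, jX, jY, hZ, hj, liftZ⟩ := exists_residuallySolvable_amalgam hX hY hX' hY'
  have hjl : ∀ v, jX (ι 0 (a v)) = jY (κ (m + 1) (b v)) := fun v => by
    simpa [cX, cY, inl] using hj (inl v)
  have hjr : ∀ v, jX (ι 1 (b v)) = jY (κ 0 (a v)) := fun v => by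
    simpa [cX, cY, inr] using hj (inr v)
  let f : ℕ → G →* Z := fun n => if n < 2 then jX.comp (ι n) else jY.comp (κ (n - 2))
  have hf : ∀ n < m + 3, ∀ v, f n (b v) = f (n + 1) (a v) := by
    rintro (_ | _ | n) hn v
    · exact congrArg jX (hι 0 one_pos v)
    · exact hjr v
    · exact congrArg jY (hκ n (by omega) v)
  have hf' : ∀ v, f (m + 3) (b v) = f 0 (a v) := fun v => (hjl v).symm
  let F : HigBar (m + 4) φ →* Z := HigBar.lift (fun i => f i.val) (fun i v => by
    have hlt : i.val < m + 4 := ZMod.val_lt i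
    by_cases hi : i.val = m + 3
    · have : i + 1 = 0 := by
        rw [← ZMod.natCast_zmod_val i, hi]
        exact_mod_cast ZMod.natCast_self (m + 4)
      rw [this, hi, ZMod.val_zero]
      exact hf' v
    · have : (i + 1).val = i.val + 1 := by
        rw [ZMod.val_add, ZMod.val_one'' (by omega), Nat.mod_eq_of_lt (by omega)]
      rw [this]
      exact hf _ (by omega) v)
  obtain ⟨EX, hEX⟩ := liftX (HigBar (m + 4) φ) (fun i => HigBar.of _ φ (i : ZMod (m + 4)))
    (fun i _ v => by
      rw [Nat.cast_succ]
      exact HigBar.of_eq _ φ _ v)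
  obtain ⟨EY, hEY⟩ := liftY (HigBar (m + 4) φ)
    (fun i => HigBar.of _ φ ((i + 2 : ℕ) : ZMod (m + 4)))
    (fun i _ v => by
      rw [show i + 1 + 2 = (i + 2) + 1 from rfl, Nat.cast_succ (i + 2)]
      exact HigBar.of_eq _ φ _ v)
  obtain ⟨E, hE, hE'⟩ := liftZ (HigBar (m + 4) φ) EX EY (fun c => by
    refine DFunLike.congr_fun (f := EX.comp cX) (g := EY.comp cY)
      (Monoid.Coprod.hom_ext (MonoidHom.ext fun v => ?_) (MonoidHom.ext fun v => ?_)) c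
    · have h0 : (((m + 1 + 2 : ℕ) : ZMod (m + 4)) + 1) = ((0 : ℕ) : ZMod (m + 4)) := by
        exact_mod_cast ZMod.natCast_self (m + 4)
      simp only [MonoidHom.comp_apply, cX, cY, Monoid.Coprod.lift_apply_inl]
      rw [hEX 0 zero_le_one, hEY (m + 1) le_rfl, ← h0]
      exact (HigBar.of_eq _ φ _ v).symm
    · have h2 : ((0 + 2 : ℕ) : ZMod (m + 4)) = ((1 : ℕ) : ZMod (m + 4)) + 1 := by norm_cast
      simp only [MonoidHom.comp_apply, cX, cY, Monoid.Coprod.lift_apply_inr]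
      rw [hEX 1 le_rfl, hEY 0 (Nat.zero_le _), h2]
      exact HigBar.of_eq _ φ _ v)
  -- A left inverse suffices, as only injectivity of `F` is needed.
  have hEF : E.comp F = MonoidHom.id _ := HigBar.hom_ext fun i g => by
    have hlt : i.val < m + 4 := ZMod.val_lt i
    rw [MonoidHom.comp_apply, HigBar.lift_of, MonoidHom.id_apply]
    dsimp only [f]
    split_ifs with h
    · rw [MonoidHom.comp_apply, hE, hEX _ (by omega), ZMod.natCast_zmod_val]
    · rw [MonoidHom.comp_apply, hE', hEY _ (by omega), Nat.sub_add_cancel (by omega),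
        ZMod.natCast_zmod_val]
  exact hZ.of_injective F (Function.LeftInverse.injective fun x => DFunLike.congr_fun hEF x)

end Main

end Higman

theorem theorem1p1 {G : Type*} [Group G] (hG : Higman.ResiduallySolvable G)
    (A B : Subgroup G) (φ : B ≃* A)
    (hπ : ∃ π : G →* A × B,
      (∀ a : A, π (a : G) = (a, 1)) ∧ (∀ b : B, π (b : G) = (1, b)))
    (k : ℕ) (hk : 4 ≤ k) :
    Higman.ResiduallySolvable (Higman.Hig k φ) ∧
      Higman.ResiduallySolvable (Higman.HigBar k φ) := by
  obtain ⟨π, hA, hB⟩ := hπ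
  obtain ⟨m, rfl⟩ := Nat.exists_eq_add_of_le' hk
  have hbar := Higman.residuallySolvable_higBar hG φ π hA hB m
  obtain ⟨f, hf⟩ := Higman.Hig.exists_injective_semidirectProduct (m + 4) φ
  exact ⟨(hbar.semidirectProduct _).of_injective f hf, hbar⟩
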